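/- Let $(R,\mathfrak m)$ be a commutative noetherian local ring, $X$ a finitely generated nonzero $R$-module and $I$ an infinite set. Put $M = X^{(I)}$ (the direct sum of copies of $X$ indexed by $I$), regarded as a submodule of the product $P = X^I$, and let $A = \bigcap_{n\ge 1}(M + \mathfrak m^n P)$ be the $\mathfrak m$-adic closure of $M$ in $P$. For an $R$-module $N$ let $\operatorname{Koass}(N)$ denote the set of coassociated prime ideals of $N$, i.e. of those $\mathfrak p\in\operatorname{Spec}(R)$ for which there is an artinian factor module $N/U$ of $N$ with $\mathfrak p = \operatorname{Ann}_R(N/U)$. Then $$\operatorname{Koass}(A/M) = \{\mathfrak p\in\operatorname{Spec}(R) \mid \operatorname{Ann}_R(X)\subseteq \mathfrak p\subsetneq \mathfrak m\}.$$ -/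

import Mathlib

/-- The set `Koass N` of coassociated prime ideals of an `R`-module `N` (for `R` noetherian local):
the primes that are the annihilator of some artinian factor module of `N`. -/
def Koass (R : Type*) [CommRing R] (N : Type*) [AddCommGroup N] [Module R N] :
    Set (PrimeSpectrum R) :=
  {p | ∃ U : Submodule R N, IsArtinian R (N ⧸ U) ∧ Module.annihilator R (N ⧸ U) = p.asIdeal}

/-- The direct sum `∐ M i`, as a submodule of the product `∏ M i`. -/
def coprodInProd (R : Type*) [CommRing R] {I : Type*} (M : I → Type*)
    [∀ i, AddCommGroup (M i)] [∀ i, Module R (M i)] : Submodule R (∀ i, M i) :=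
  LinearMap.range (DFinsupp.coeFnLinearMap R : (Π₀ i, M i) →ₗ[R] ∀ i, M i)

/-- The `𝔪`-adic closure `A = ⋂_{n ≥ 1} (∐ M i + 𝔪 ^ n • ∏ M i)` of the direct sum in the
product. -/
def adicClosure (R : Type*) [CommRing R] [IsLocalRing R] {I : Type*} (M : I → Type*)
    [∀ i, AddCommGroup (M i)] [∀ i, Module R (M i)] : Submodule R (∀ i, M i) :=
  ⨅ (n : ℕ) (_ : 1 ≤ n),
    (coprodInProd R M ⊔ IsLocalRing.maximalIdeal R ^ n • (⊤ : Submodule R (∀ i, M i)))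

/-! Every quotient of `A / M` is killed by `Ann X`. Moreover `A = 𝔪 A + M`: the entries of a family
in `A` tend to zero 𝔪-adically, and expanding them in generators of `𝔪` costs only one power of `𝔪`.
So a quotient of `A / M` killed by `𝔪` is zero, and `𝔪` is not coassociated.

Conversely, let `Ann X ≤ p < 𝔪` and take `x` nonzero in `X_p / p X_p`. For `s ∈ 𝔪` outside `p` the
family `w_s = (s ^ n x)` lies in `A`. With one `s` per class modulo `p`, the elements `s w_s` are
independent over `R / p` modulo the families that vanish in `X_p / p X_p` almost everywhere, by
Dedekind's independence of characters. So some quotient of `A / M`, killed by `p`, sends all `s w_s`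
to one nonzero element `u`. Enlarging the kernel while avoiding `u` makes `u` lie in every nonzero
submodule, and this forces the quotient to be artinian. No `r ∉ p` kills it, for then some `s`
would. -/

open IsLocalRing Polynomial

/-! ### Artinian modules via the Rees algebra -/

/-- The ideal of the Rees algebra of `J` formed by the elements whose `n`-th coefficient kills the
part of `U` that is annihilated by `J ^ (n + 1)`. -/
def reesAnnihilator {R L : Type*} [CommRing R] [AddCommGroup L] [Module R L] (J : Ideal R)
    (U : Submodule R L) : Ideal (reesAlgebra J) where
  carrier := {f | ∀ n, ∀ z ∈ U, (∀ r ∈ J ^ (n + 1), r • z = 0) → (f : R[X]).coeff n • z = 0}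
  zero_mem' := by intro n z _ _; simp
  add_mem' := by
    intro f g hf hg n z hz hn
    simp [add_smul, hf n z hz hn, hg n z hz hn]
  smul_mem' := by
    intro c f hf n z hz hn
    change ((c : R[X]) * (f : R[X])).coeff n • z = 0
    rw [mul_comm, coeff_mul, Finset.sum_smul]
    refine Finset.sum_eq_zero fun ij hij => ?_
    rw [Finset.HasAntidiagonal.mem_antidiagonal] at hij
    rw [mul_smul]
    -- With `i + j = n`, the coefficient of `c` in `J ^ j` takes elements killed by `J ^ (n + 1)` to
    -- elements killed by `J ^ (i + 1)`.
    refine hf _ _ (U.smul_mem _ hz) fun r hr => ?_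
    rw [smul_smul]
    refine hn _ ?_
    rw [← hij, add_right_comm, pow_add]
    exact Ideal.mul_mem_mul hr (c.2 _)

theorem reesAnnihilator_anti {R L : Type*} [CommRing R] [AddCommGroup L] [Module R L]
    (J : Ideal R) : Antitone (reesAnnihilator J : Submodule R L → Ideal (reesAlgebra J)) :=
  fun _ _ h _ hf n z hz => hf n z (h hz)

section SimpleEssentialSocle

variable {R L : Type*} [CommRing R] [IsLocalRing R] [AddCommGroup L] [Module R L] {u : L}

theorem smul_eq_zero_of_mem_every_ne_bot (h : ∀ U : Submodule R L, U ≠ ⊥ → u ∈ U)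
    {a : R} (ha : a ∈ maximalIdeal R) : a • u = 0 := by
  by_contra hau
  obtain ⟨b, hb⟩ := Submodule.mem_span_singleton.1
    (h (Submodule.span R {a • u}) (by simpa using hau))
  have hunit : IsUnit (1 - b * a) := by
    refine (isUnit_or_isUnit_one_sub_self (b * a)).resolve_left fun hba => ?_
    exact (mem_maximalIdeal _).1 (Ideal.mul_mem_left _ b ha) hba
  have hu : u = 0 := by
    apply hunit.smul_left_cancel.1
    rw [sub_smul, mul_smul, hb, one_smul, sub_self, smul_zero]
  exact hau (by rw [hu, smul_zero])

theorem exists_smul_eq_of_mem_every_ne_bot (hu : u ≠ 0)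
    (h : ∀ U : Submodule R L, U ≠ ⊥ → u ∈ U) {y : L} (hy : ∀ r ∈ maximalIdeal R, r • y = 0) :
    ∃ a : R, y = a • u := by
  by_cases hy0 : y = 0
  · exact ⟨0, by simp [hy0]⟩
  obtain ⟨a, ha⟩ := Submodule.mem_span_singleton.1
    (h (Submodule.span R {y}) (by simpa using hy0))
  have hunit : IsUnit a := by
    by_contra hna
    exact hu (by rw [← ha, hy a ((mem_maximalIdeal _).2 hna)])
  obtain ⟨c, rfl⟩ := hunit
  refine ⟨(c⁻¹ : Rˣ), ?_⟩
  rw [← ha, smul_smul, Units.inv_mul, one_smul]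

theorem smul_eq_zero_iff_of_mem_every_ne_bot (hu : u ≠ 0)
    (h : ∀ U : Submodule R L, U ≠ ⊥ → u ∈ U) (a : R) : a • u = 0 ↔ residue R a = 0 := by
  rw [residue_eq_zero_iff]
  refine ⟨fun ha => ?_, smul_eq_zero_of_mem_every_ne_bot h⟩
  by_contra hna
  exact hu ((notMem_maximalIdeal.1 hna).smul_eq_zero.1 ha)

variable [IsNoetherianRing R]

/-- Otherwise `u` would lie in `𝔪 ^ n x` for every `n`, against Krull's intersection theorem for the
cyclic module `R x`. -/
theorem exists_pow_smul_eq_zero_of_mem_every_ne_bot (hu : u ≠ 0)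
    (h : ∀ U : Submodule R L, U ≠ ⊥ → u ∈ U) (x : L) :
    ∃ n : ℕ, ∀ r ∈ maximalIdeal R ^ n, r • x = 0 := by
  by_contra! hx
  have hmem : ∀ n : ℕ, u ∈ maximalIdeal R ^ n • Submodule.span R {x} := by
    intro n
    refine h _ fun hbot => ?_
    obtain ⟨r, hr, hrx⟩ := hx n
    refine hrx ?_
    rw [← Submodule.mem_bot R, ← hbot]
    exact Submodule.smul_mem_smul hr (Submodule.mem_span_singleton_self x)
  have hux : u ∈ Submodule.span R {x} := by simpa using hmem 0
  have hzero : (⟨u, hux⟩ : Submodule.span R {x}) ∈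
      (⨅ i : ℕ, maximalIdeal R ^ i • ⊤ : Submodule R (Submodule.span R {x})) := by
    rw [Submodule.mem_iInf]
    intro n
    rw [Submodule.mem_smul_top_iff]
    exact hmem n
  rw [Ideal.iInf_pow_smul_eq_bot_of_isLocalRing (h := (maximalIdeal.isMaximal R).ne_top)] at hzero
  exact hu (by simpa using hzero)

/-- Duality for one socle layer: an element killed by `𝔪 ^ (n + 1)` maps `𝔪 ^ n` into the line of
`u`, so it is a functional on the finite-dimensional space `𝔪 ^ n / 𝔪 ^ (n + 1)`. A functional
outside the subspace coming from `W` is detected by some `f` that kills `W`. -/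
theorem exists_mem_forall_pow_smul_sub_eq_zero (hu : u ≠ 0)
    (h : ∀ U : Submodule R L, U ≠ ⊥ → u ∈ U) (n : ℕ) (W : Submodule R L)
    (hW : ∀ w ∈ W, ∀ r ∈ maximalIdeal R ^ (n + 1), r • w = 0) (z : L)
    (hz : ∀ r ∈ maximalIdeal R ^ (n + 1), r • z = 0)
    (hzW : ∀ f ∈ maximalIdeal R ^ n, (∀ w ∈ W, f • w = 0) → f • z = 0) :
    ∃ w ∈ W, ∀ f ∈ maximalIdeal R ^ n, f • (z - w) = 0 := by
  obtain ⟨m, g, hg⟩ := Submodule.fg_iff_exists_fin_generating_family.1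
    (IsNoetherian.noetherian (maximalIdeal R ^ n))
  have hgmem : ∀ i, g i ∈ maximalIdeal R ^ n := fun i => by
    rw [← hg]
    exact Submodule.subset_span ⟨i, rfl⟩
  have hcoord : ∀ y : L, (∀ r ∈ maximalIdeal R ^ (n + 1), r • y = 0) →
      ∃ a : Fin m → R, ∀ i, g i • y = a i • u := by
    intro y hy
    choose a ha using fun i => exists_smul_eq_of_mem_every_ne_bot hu h (y := g i • y)
      fun r hr => by
        rw [smul_smul]
        refine hy _ ?_
        rw [pow_succ']
        exact Ideal.mul_mem_mul hr (hgmem i)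
    exact ⟨a, ha⟩
  let W' : Submodule (ResidueField R) (Fin m → ResidueField R) :=
    { carrier := {c | ∃ w ∈ W, ∃ a : Fin m → R, (∀ i, g i • w = a i • u) ∧
        c = fun i => residue R (a i)}
      zero_mem' := ⟨0, W.zero_mem, 0, by simp, by ext; simp⟩
      add_mem' := by
        rintro _ _ ⟨w, hw, a, ha, rfl⟩ ⟨w', hw', a', ha', rfl⟩
        exact ⟨w + w', W.add_mem hw hw', a + a',
          fun i => by simp [ha, ha', add_smul], by ext; simp⟩
      smul_mem' := by
        rintro c _ ⟨w, hw, a, ha, rfl⟩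
        obtain ⟨c, rfl⟩ := residue_surjective c
        refine ⟨c • w, W.smul_mem c hw, c • a, fun i => ?_, by ext; simp⟩
        rw [smul_comm, ha, Pi.smul_apply, smul_assoc] }
  obtain ⟨a, ha⟩ := hcoord z hz
  by_cases hmem : (fun i => residue R (a i)) ∈ W'
  · obtain ⟨w, hw, b, hb, hab⟩ := hmem
    refine ⟨w, hw, fun f hf => ?_⟩
    have hle : maximalIdeal R ^ n ≤ LinearMap.ker (LinearMap.toSpanSingleton R L (z - w)) := by
      rw [← hg, Submodule.span_le]
      rintro _ ⟨i, rfl⟩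
      have : residue R (a i - b i) = 0 := by
        rw [map_sub, sub_eq_zero]
        exact congrFun hab i
      rw [← smul_eq_zero_iff_of_mem_every_ne_bot hu h] at this
      simpa [smul_sub, ha, hb, sub_smul] using this
    simpa using hle hf
  · exfalso
    obtain ⟨φ, hφ, hφW⟩ := Submodule.exists_le_ker_of_notMem hmem
    choose c hc using fun i => residue_surjective (R := R) (φ (Pi.single i 1))
    have hφc : ∀ b : Fin m → R, φ (fun i => residue R (b i)) = residue R (∑ i, c i * b i) := by
      intro b
      rw [LinearMap.pi_apply_eq_sum_univ φ]
      simp only [map_sum, map_mul, hc, smul_eq_mul]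
      refine Finset.sum_congr rfl fun i _ => ?_
      rw [mul_comm]
      congr 2
      ext j
      simp [Pi.single_apply, eq_comm]
    have hsum : ∀ (y : L) (b : Fin m → R), (∀ i, g i • y = b i • u) →
        (∑ i, c i * g i) • y = (∑ i, c i * b i) • u := by
      intro y b hb
      simp only [Finset.sum_smul, mul_smul, hb]
    refine hφ ?_
    rw [hφc, ← smul_eq_zero_iff_of_mem_every_ne_bot hu h, ← hsum z a ha]
    refine hzW _ (Ideal.sum_mem _ fun i _ => Ideal.mul_mem_left _ _ (hgmem i)) fun w hw => ?_
    obtain ⟨b, hb⟩ := hcoord w (hW w hw)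
    rw [hsum w b hb, smul_eq_zero_iff_of_mem_every_ne_bot hu h, ← hφc]
    exact hφW ⟨w, hw, b, hb, rfl⟩

/-- Over a noetherian local ring, a module with a nonzero element that lies in every nonzero
submodule is artinian. -/
theorem isArtinian_of_mem_every_ne_bot (hu : u ≠ 0)
    (h : ∀ U : Submodule R L, U ≠ ⊥ → u ∈ U) : IsArtinian R L := by
  -- The Rees algebra of `𝔪` is noetherian, so a strictly antitone map into its ideals gives the
  -- descending chain condition.
  refine StrictAnti.wellFoundedLT (f := reesAnnihilator (L := L) (maximalIdeal R)) ?_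
  intro U V hUV
  refine lt_of_le_of_ne (reesAnnihilator_anti _ hUV.le) fun heq => hUV.not_ge ?_
  have hlayer : ∀ n : ℕ, ∀ z ∈ V, (∀ r ∈ maximalIdeal R ^ n, r • z = 0) → z ∈ U := by
    intro n
    induction n with
    | zero =>
      intro z _ hn
      have : z = 0 := by simpa using hn 1 (by simp)
      rw [this]
      exact U.zero_mem
    | succ n ih =>
      intro z hz hn
      have hker : ∀ f ∈ maximalIdeal R ^ n,
          (∀ w ∈ U ⊓ Submodule.torsionBySet R L (maximalIdeal R ^ (n + 1) : Ideal R),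
            f • w = 0) → f • z = 0 := by
        intro f hf hfW
        -- Only the degree `n` coefficient of `f X ^ n` imposes a condition, so equality of the two
        -- ideals carries the vanishing of `f` from the layer of `U` to that of `V`.
        have hfU : (⟨monomial n f, reesAlgebra.monomial_mem.2 hf⟩ :
            reesAlgebra (maximalIdeal R)) ∈ reesAnnihilator (maximalIdeal R) U := by
          intro k y hy hk
          rw [coeff_monomial]
          split_ifs with hnk
          · subst hnk
            exact hfW y ⟨hy, (Submodule.mem_torsionBySet_iff _ _).2 fun r => hk r r.2⟩
          · exact zero_smul _ _
        rw [← heq] at hfU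
        simpa using hfU n z hz hn
      obtain ⟨w, hw, hwz⟩ := exists_mem_forall_pow_smul_sub_eq_zero hu h n
        (U ⊓ Submodule.torsionBySet R L (maximalIdeal R ^ (n + 1) : Ideal R))
        (fun w hw r hr => (Submodule.mem_torsionBySet_iff _ _).1 hw.2 ⟨r, hr⟩) z hn hker
      have := U.add_mem (ih (z - w) (V.sub_mem hz (hUV.le hw.1)) hwz) hw.1
      rwa [sub_add_cancel] at this
  intro z hz
  obtain ⟨n, hn⟩ := exists_pow_smul_eq_zero_of_mem_every_ne_bot hu h z
  exact hlayer n z hz hn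

end SimpleEssentialSocle

/-! ### Artinian quotients that keep given elements nonzero -/

/-- For `U` maximal among the submodules that contain `T` and avoid `u`, the image of `u` lies in
every nonzero submodule of the quotient. -/
theorem exists_isArtinian_quotient_notMem {R N : Type*} [CommRing R] [IsLocalRing R]
    [IsNoetherianRing R] [AddCommGroup N] [Module R N] {T : Submodule R N} {u : N} (hu : u ∉ T) :
    ∃ U : Submodule R N, T ≤ U ∧ u ∉ U ∧ IsArtinian R (N ⧸ U) := by
  obtain ⟨U, hTU, hU⟩ := zorn_le_nonempty₀ {U : Submodule R N | u ∉ U} (fun c hc hchain V hV =>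
    ⟨sSup c, fun hmem => by
      obtain ⟨W, hW, huW⟩ := (Submodule.mem_sSup_of_directed ⟨V, hV⟩ hchain.directedOn).1 hmem
      exact hc hW huW, fun _ => le_sSup⟩) T hu
  refine ⟨U, hTU, hU.prop, isArtinian_of_mem_every_ne_bot (u := U.mkQ u) ?_ fun V hV => ?_⟩
  · simpa using hU.prop
  · by_contra huV
    refine hV ?_
    have hle : U ≤ V.comap U.mkQ := Submodule.le_comap_mkQ U V
    have := hU.le_of_ge (y := V.comap U.mkQ) huV hle
    rw [eq_bot_iff]
    intro y hy
    obtain ⟨x, rfl⟩ := U.mkQ_surjective y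
    simpa using this hy

/-- A family that is independent modulo `p` and `K` can be separated from zero in an artinian
quotient. -/
theorem exists_isArtinian_quotient_forall_notMem {R N Λ : Type*} [CommRing R] [IsLocalRing R]
    [IsNoetherianRing R] [AddCommGroup N] [Module R N] [Nonempty Λ] (p : Ideal R) (hp : p ≠ ⊤)
    (K : Submodule R N) (v : Λ → N)
    (hv : ∀ c : Λ →₀ R, Finsupp.linearCombination R v c ∈ K → ∀ l, c l ∈ p) :
    ∃ U : Submodule R N, K ≤ U ∧ IsArtinian R (N ⧸ U) ∧ ∀ l, v l ∉ U := by
  obtain ⟨l₀⟩ := ‹Nonempty Λ›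
  -- Dividing by the combinations of degree zero identifies all `v l`. If their common image
  -- vanished modulo `K`, a combination of degree one would have all its coefficients in `p`.
  let deg : (Λ →₀ R) →ₗ[R] R := Finsupp.linearCombination R fun _ => 1
  let D : Submodule R N := (LinearMap.ker deg).map (Finsupp.linearCombination R v)
  have hu : v l₀ ∉ K ⊔ D := by
    intro hmem
    obtain ⟨k, hk, _, ⟨c, hc, rfl⟩, hkc⟩ := Submodule.mem_sup.1 hmem
    have hcoef := hv (Finsupp.single l₀ 1 - c) (by simpa [← hkc] using hk)
    refine hp ((Ideal.eq_top_iff_one p).2 ?_)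
    have hone : deg (Finsupp.single l₀ 1 - c) = 1 := by
      rw [map_sub, LinearMap.mem_ker.1 hc]
      simp [deg]
    rw [← hone, Finsupp.linearCombination_apply]
    exact Ideal.sum_mem _ fun l _ => Ideal.mul_mem_right _ _ (hcoef l)
  obtain ⟨U, hU, huU, hart⟩ := exists_isArtinian_quotient_notMem hu
  refine ⟨U, le_sup_left.trans hU, hart, fun l hl => huU ?_⟩
  have hdiff : v l₀ - v l ∈ U := hU (Submodule.mem_sup_right
    ⟨Finsupp.single l₀ 1 - Finsupp.single l 1, by simp [deg], by simp⟩)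
  simpa using U.add_mem hdiff hl

/-! ### Coordinatewise description of the closure -/

theorem exists_eq_sum_smul_of_mem_span_smul {R X ι : Type*} [CommRing R] [AddCommGroup X]
    [Module R X] [Fintype ι] (g : ι → R) (N : Submodule R X) {y : X}
    (hy : y ∈ Ideal.span (Set.range g) • N) :
    ∃ b : ι → X, (∀ k, b k ∈ N) ∧ y = ∑ k, g k • b k := by
  refine Submodule.smul_induction_on hy (fun r hr x hx => ?_) ?_
  · obtain ⟨c, rfl⟩ := (Submodule.mem_span_range_iff_exists_fun R).1 hr
    refine ⟨fun k => c k • x, fun k => N.smul_mem _ hx, ?_⟩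
    simp [Finset.sum_smul, smul_smul, mul_comm]
  · rintro _ _ ⟨b, hb, rfl⟩ ⟨b', hb', rfl⟩
    exact ⟨b + b', fun k => N.add_mem (hb k) (hb' k), by
      simp [smul_add, Finset.sum_add_distrib]⟩

theorem exists_fintype_span_range_eq {R : Type*} [CommRing R] [IsNoetherianRing R] (J : Ideal R) :
    ∃ (r : ℕ) (g : Fin r → R), Ideal.span (Set.range g) = J :=
  Submodule.fg_iff_exists_fin_generating_family.1 (IsNoetherian.noetherian J)

theorem mem_smul_top_pi_iff {R X I : Type*} [CommRing R] [IsNoetherianRing R] [AddCommGroup X]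
    [Module R X] (J : Ideal R) (f : I → X) :
    f ∈ J • (⊤ : Submodule R (I → X)) ↔ ∀ i, f i ∈ J • (⊤ : Submodule R X) := by
  constructor
  · intro hf i
    refine Submodule.smul_induction_on hf (fun r hr x _ => ?_) fun x y hx hy => ?_
    · exact Submodule.smul_mem_smul hr trivial
    · exact Submodule.add_mem _ hx hy
  · intro hf
    obtain ⟨r, g, rfl⟩ := exists_fintype_span_range_eq J
    choose b _ hb using fun i => exists_eq_sum_smul_of_mem_span_smul g ⊤ (hf i)
    have : f = ∑ k, g k • fun i => b i k := by
      ext i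
      simp [hb i]
    rw [this]
    exact Submodule.sum_mem _ fun k _ =>
      Submodule.smul_mem_smul (Ideal.subset_span ⟨k, rfl⟩) trivial

theorem mem_coprodInProd_iff {R X I : Type*} [CommRing R] [AddCommGroup X] [Module R X]
    (f : I → X) : f ∈ coprodInProd R (fun _ : I => X) ↔ {i | f i ≠ 0}.Finite := by
  classical
  constructor
  · rintro ⟨x, rfl⟩
    exact x.finite_support
  · intro hf
    refine ⟨DFinsupp.mk hf.toFinset fun i => f i, ?_⟩
    ext i
    by_cases hi : f i = 0 <;> simp [DFinsupp.coeFnLinearMap, hi]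

section LocalRing

variable {R X I : Type*} [CommRing R] [IsLocalRing R] [IsNoetherianRing R] [AddCommGroup X]
  [Module R X]

theorem mem_adicClosure_iff (f : I → X) :
    f ∈ adicClosure R (fun _ : I => X) ↔
      ∀ n : ℕ, {i | f i ∉ maximalIdeal R ^ n • (⊤ : Submodule R X)}.Finite := by
  classical
  simp only [adicClosure, Submodule.mem_iInf]
  constructor
  · intro hf n
    rcases Nat.eq_zero_or_pos n with rfl | hn
    · simp
    obtain ⟨x, hx, y, hy, rfl⟩ := Submodule.mem_sup.1 (hf n hn)
    rw [mem_coprodInProd_iff] at hx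
    rw [mem_smul_top_pi_iff] at hy
    refine hx.subset fun i hi hx0 => hi ?_
    simpa [hx0] using hy i
  · intro hf n _
    refine Submodule.mem_sup.2
      ⟨fun i => if f i ∈ maximalIdeal R ^ n • (⊤ : Submodule R X) then 0 else f i, ?_,
        fun i => if f i ∈ maximalIdeal R ^ n • (⊤ : Submodule R X) then f i else 0, ?_, ?_⟩
    · rw [mem_coprodInProd_iff]
      refine (hf n).subset fun i hi hmem => hi ?_
      simp [hmem]
    · rw [mem_smul_top_pi_iff]
      intro i
      split_ifs with hi
      · exact hi
      · exact Submodule.zero_mem _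
    · ext i
      by_cases hi : f i ∈ maximalIdeal R ^ n • (⊤ : Submodule R X) <;> simp [hi]

/-! ### Exclusion of the maximal ideal -/

/-- A single `b` must serve all `n`: for nonzero `y` in `𝔪 X`, expand `y` at the largest power of
`𝔪` that allows it, which exists by Krull's intersection theorem. -/
theorem exists_coeff_mem_pow_smul_top [Module.Finite R X] {r : ℕ} {g : Fin r → R}
    (hg : Ideal.span (Set.range g) = maximalIdeal R) (y : X) :
    ∃ b : Fin r → X, (y ∈ maximalIdeal R • (⊤ : Submodule R X) → y = ∑ k, g k • b k) ∧
      ∀ n, y ∈ maximalIdeal R ^ (n + 1) • (⊤ : Submodule R X) →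
        ∀ k, b k ∈ maximalIdeal R ^ n • (⊤ : Submodule R X) := by
  classical
  by_cases hy0 : y = 0
  · exact ⟨0, by simp [hy0], fun n _ k => Submodule.zero_mem _⟩
  by_cases hy1 : y ∈ maximalIdeal R • (⊤ : Submodule R X)
  swap
  · refine ⟨0, fun h => absurd h hy1, fun n _ k => Submodule.zero_mem _⟩
  have hex : ∃ n, y ∉ maximalIdeal R ^ (n + 1) • (⊤ : Submodule R X) := by
    by_contra! hall
    have hmem : y ∈ (⨅ i : ℕ, maximalIdeal R ^ i • ⊤ : Submodule R X) := by
      rw [Submodule.mem_iInf]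
      exact fun n => Submodule.smul_mono_left (Ideal.pow_le_pow_right n.le_succ) (hall n)
    rw [Ideal.iInf_pow_smul_eq_bot_of_isLocalRing
      (h := (maximalIdeal.isMaximal R).ne_top)] at hmem
    exact hy0 (by simpa using hmem)
  obtain ⟨n, hn⟩ : ∃ n, Nat.find hex = n + 1 := by
    refine Nat.exists_eq_succ_of_ne_zero fun h0 => ?_
    have := Nat.find_spec hex
    rw [h0] at this
    exact this (by simpa using hy1)
  have hyn : y ∈ maximalIdeal R ^ (n + 1) • (⊤ : Submodule R X) := by
    by_contra hcon
    have := Nat.find_min' hex hcon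
    omega
  rw [pow_succ', mul_smul, ← hg] at hyn
  obtain ⟨b, hb, hyb⟩ := exists_eq_sum_smul_of_mem_span_smul g _ hyn
  rw [hg] at hb
  refine ⟨b, fun _ => hyb, fun k hk j => ?_⟩
  have hkn : k ≤ n := by
    by_contra! hlt
    have hspec := Nat.find_spec hex
    rw [hn] at hspec
    exact hspec (Submodule.smul_mono_left (Ideal.pow_le_pow_right (by omega)) hk)
  exact Submodule.smul_mono_left (Ideal.pow_le_pow_right hkn) (hb j)

/-- The coefficient families stay in the closure, and the expansion fails only at the finitely many
indices with entry outside `𝔪 X`. -/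
theorem adicClosure_le_maximalIdeal_smul_sup_coprodInProd [Module.Finite R X] :
    adicClosure R (fun _ : I => X) ≤
      maximalIdeal R • adicClosure R (fun _ : I => X) ⊔ coprodInProd R (fun _ : I => X) := by
  intro f hf
  obtain ⟨r, g, hg⟩ := exists_fintype_span_range_eq (maximalIdeal R)
  choose b hfb hb using fun i => exists_coeff_mem_pow_smul_top hg (f i)
  rw [mem_adicClosure_iff] at hf
  refine Submodule.mem_sup.2 ⟨∑ k, g k • fun i => b i k, ?_, f - ∑ k, g k • fun i => b i k, ?_, ?_⟩
  · refine Submodule.sum_mem _ fun k _ => Submodule.smul_mem_smul ?_ ?_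
    · rw [← hg]
      exact Ideal.subset_span ⟨k, rfl⟩
    · rw [mem_adicClosure_iff]
      exact fun n => (hf (n + 1)).subset fun i hi hmem => hi (hb i n hmem k)
  · rw [mem_coprodInProd_iff]
    refine (hf 1).subset fun i hi hmem => hi ?_
    rw [pow_one] at hmem
    simpa [sub_eq_zero] using hfb i hmem
  · abel

/-- Every quotient of `A / M` equals its own product with the maximal ideal, so that the maximal
ideal is not coassociated. -/
theorem annihilator_ne_maximalIdeal [Module.Finite R X]
    (U : Submodule R (adicClosure R (fun _ : I => X) ⧸
      (coprodInProd R (fun _ : I => X)).submoduleOf (adicClosure R (fun _ : I => X)))) :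
    Module.annihilator R (_ ⧸ U) ≠ maximalIdeal R := by
  intro hann
  have hle : adicClosure R (fun _ : I => X) ≤
      ((U.comap (Submodule.mkQ _)).map (adicClosure R (fun _ : I => X)).subtype) ⊔
        coprodInProd R (fun _ : I => X) ⊓ adicClosure R (fun _ : I => X) := by
    intro f hf
    obtain ⟨y, hy, z, hz, rfl⟩ :=
      Submodule.mem_sup.1 (adicClosure_le_maximalIdeal_smul_sup_coprodInProd hf)
    have hyA : y ∈ adicClosure R (fun _ : I => X) := Submodule.smul_le_right hy
    refine Submodule.add_mem_sup ?_ ⟨hz, by simpa using Submodule.sub_mem _ hf hyA⟩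
    refine Submodule.smul_induction_on hy (fun r hr x hx => ?_) fun _ _ => Submodule.add_mem _
    refine ⟨r • ⟨x, hx⟩, ?_, rfl⟩
    rw [← hann, Module.mem_annihilator] at hr
    have := hr (U.mkQ (Submodule.mkQ _ ⟨x, hx⟩))
    rw [← map_smul, Submodule.mkQ_apply, Submodule.Quotient.mk_eq_zero, ← map_smul] at this
    exact this
  have htop : U = ⊤ := by
    rw [eq_top_iff]
    intro x _
    obtain ⟨⟨f, hf⟩, rfl⟩ := Submodule.mkQ_surjective _ x
    obtain ⟨_, ⟨y, hy, rfl⟩, z, hz, hyz⟩ := Submodule.mem_sup.1 (hle hf)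
    have hfy : (⟨f, hf⟩ : adicClosure R (fun _ : I => X)) = y + ⟨z, hz.2⟩ :=
      Subtype.ext hyz.symm
    rw [hfy, map_add]
    refine U.add_mem hy ?_
    have : Submodule.mkQ ((coprodInProd R (fun _ : I => X)).submoduleOf
        (adicClosure R (fun _ : I => X))) ⟨z, hz.2⟩ = 0 := by
      rw [Submodule.mkQ_apply, Submodule.Quotient.mk_eq_zero]
      exact hz.1
    rw [this]
    exact U.zero_mem
  refine (maximalIdeal.isMaximal R).ne_top ?_
  rw [← hann, Module.annihilator_eq_top_iff, htop]
  infer_instance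

end LocalRing

/-! ### Geometric families and the primes below the maximal ideal -/

/-- The vectors that a multiplier outside the prime `p` takes into `p X`. -/
def torsionModulo {R : Type*} [CommRing R] (X : Type*) [AddCommGroup X] [Module R X]
    (p : Ideal R) [hp : p.IsPrime] : Submodule R X where
  carrier := {x | ∃ r ∉ p, r • x ∈ p • (⊤ : Submodule R X)}
  zero_mem' := ⟨1, p.one_notMem, by simp⟩
  add_mem' := by
    rintro x y ⟨r, hr, hx⟩ ⟨s, hs, hy⟩
    refine ⟨r * s, hp.mul_notMem hr hs, ?_⟩
    rw [smul_add]
    refine Submodule.add_mem _ ?_ ?_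
    · rw [mul_comm, mul_smul]
      exact Submodule.smul_mem _ _ hx
    · rw [mul_smul]
      exact Submodule.smul_mem _ _ hy
  smul_mem' := by
    rintro c x ⟨r, hr, hx⟩
    refine ⟨r, hr, ?_⟩
    rw [smul_comm]
    exact Submodule.smul_mem _ _ hx

theorem smul_mem_torsionModulo_of_mem {R X : Type*} [CommRing R] [AddCommGroup X] [Module R X]
    {p : Ideal R} [p.IsPrime] {r : R} (hr : r ∈ p) (x : X) : r • x ∈ torsionModulo X p :=
  ⟨1, p.one_notMem, by simpa using Submodule.smul_mem_smul hr (Submodule.mem_top (x := x))⟩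

theorem mem_of_smul_mem_torsionModulo {R X : Type*} [CommRing R] [AddCommGroup X] [Module R X]
    {p : Ideal R} [hp : p.IsPrime] {r : R} {x : X} (hx : x ∉ torsionModulo X p)
    (hrx : r • x ∈ torsionModulo X p) : r ∈ p := by
  by_contra hr
  obtain ⟨s, hs, hsx⟩ := hrx
  exact hx ⟨s * r, hp.mul_notMem hs hr, by rwa [mul_smul]⟩

/-- Since `X` is finite, `p` lies in the support of `X / p X`, so some element survives localization
at `p`. -/
theorem exists_notMem_torsionModulo {R X : Type*} [CommRing R] [AddCommGroup X] [Module R X]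
    [Module.Finite R X] {p : Ideal R} [hp : p.IsPrime] (hX : Module.annihilator R X ≤ p) :
    ∃ x : X, x ∉ torsionModulo X p := by
  have hmem : (⟨p, hp⟩ : PrimeSpectrum R) ∈
      Module.support R (X ⧸ (p • ⊤ : Submodule R X)) := by
    rw [Module.support_quotient]
    exact ⟨Module.mem_support_iff_of_finite.2 hX, fun _ h => h⟩
  obtain ⟨m, hm⟩ := Module.mem_support_iff'.1 hmem
  obtain ⟨x, rfl⟩ := Submodule.mkQ_surjective _ m
  refine ⟨x, fun ⟨r, hr, hrx⟩ => hm r hr ?_⟩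
  rw [← map_smul, Submodule.mkQ_apply, Submodule.Quotient.mk_eq_zero]
  exact hrx

/-- The families that lie in `Y` at almost every index. -/
def almostEverywhereMem {R X : Type*} [CommRing R] [AddCommGroup X] [Module R X] (I : Type*)
    (Y : Submodule R X) : Submodule R (I → X) where
  carrier := {f | {i | f i ∉ Y}.Finite}
  zero_mem' := by simp
  add_mem' := by
    intro f g hf hg
    refine (hf.union hg).subset fun i hi => ?_
    by_contra hcon
    exact hi (Y.add_mem (not_not.1 fun h => hcon (Or.inl h)) (not_not.1 fun h => hcon (Or.inr h)))
  smul_mem' := fun c f hf => hf.subset fun i hi hmem => hi (Y.smul_mem c hmem)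

theorem coprodInProd_le_almostEverywhereMem {R X I : Type*} [CommRing R] [AddCommGroup X]
    [Module R X] (Y : Submodule R X) :
    coprodInProd R (fun _ : I => X) ≤ almostEverywhereMem I Y := by
  intro f hf
  rw [mem_coprodInProd_iff] at hf
  refine hf.subset fun i hi h0 => hi ?_
  rw [h0]
  exact Y.zero_mem

/-- The family `s ^ n • x` along an embedding of `ℕ`, extended by zero. -/
noncomputable def powFamily {R X I : Type*} [CommRing R] [AddCommGroup X] [Module R X]
    (e : ℕ ↪ I) (x : X) (s : R) : I → X :=
  Function.extend e (fun n => s ^ n • x) 0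

theorem powFamily_apply {R X I : Type*} [CommRing R] [AddCommGroup X] [Module R X]
    (e : ℕ ↪ I) (x : X) (s : R) (n : ℕ) : powFamily e x s (e n) = s ^ n • x :=
  e.injective.extend_apply _ _ _

theorem powFamily_mem_adicClosure {R X I : Type*} [CommRing R] [IsLocalRing R]
    [IsNoetherianRing R] [AddCommGroup X] [Module R X] (e : ℕ ↪ I) (x : X) {s : R}
    (hs : s ∈ maximalIdeal R) : powFamily e x s ∈ adicClosure R (fun _ : I => X) := by
  rw [mem_adicClosure_iff]
  intro n
  refine ((Set.finite_lt_nat n).image e).subset fun i hi => ?_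
  by_cases hie : ∃ k, e k = i
  · obtain ⟨k, rfl⟩ := hie
    refine ⟨k, ?_, rfl⟩
    by_contra hkn
    refine hi ?_
    rw [powFamily_apply]
    exact Submodule.smul_mem_smul
      (Ideal.pow_le_pow_right (not_lt.1 hkn) (Ideal.pow_mem_pow hs k)) trivial
  · refine absurd ?_ hi
    rw [powFamily, Function.extend_apply' _ _ _ hie]
    exact Submodule.zero_mem _

/-- Geometric sequences with distinct nonzero ratios in a domain are linearly independent, even
after finitely many terms are dropped. -/
theorem eq_zero_of_sum_mul_pow_eq_zero {D Λ : Type*} [CommRing D] [IsDomain D] {d : Λ → D}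
    (hd : Function.Injective d) (hd0 : ∀ l, d l ≠ 0) (c : Λ → D) (t : Finset Λ) (m : ℕ)
    (h : ∀ n, m ≤ n → ∑ l ∈ t, c l * d l ^ n = 0) {l : Λ} (hl : l ∈ t) : c l = 0 := by
  -- The sequences `n ↦ d l ^ n` are distinct characters of the monoid `ℕ`. The dropped terms are
  -- absorbed by the factor `d l ^ m` in the coefficients.
  have hli := (linearIndependent_monoidHom (Multiplicative ℕ) D).comp
    (fun l => powersHom D (d l)) ((powersHom D).injective.comp hd)
  have := linearIndependent_iff'.1 hli t (fun l => c l * d l ^ m) (by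
    ext n
    have := h (m + n.toAdd) (Nat.le_add_right _ _)
    simpa [pow_add, mul_assoc, Finset.sum_apply] using this) l hl
  exact (mul_eq_zero.1 this).resolve_right (pow_ne_zero _ (hd0 l))

theorem mem_of_linearCombination_smul_powFamily_mem {R X I Λ : Type*} [CommRing R]
    [AddCommGroup X] [Module R X] {p : Ideal R} [p.IsPrime] (e : ℕ ↪ I) {x : X}
    (hx : x ∉ torsionModulo X p) {s : Λ → R}
    (hs : Function.Injective fun l => Ideal.Quotient.mk p (s l)) (hsp : ∀ l, s l ∉ p)
    (c : Λ →₀ R)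
    (hc : Finsupp.linearCombination R (fun l => s l • powFamily e x (s l)) c ∈
      almostEverywhereMem I (torsionModulo X p)) (l : Λ) : c l ∈ p := by
  by_cases hl : l ∈ c.support
  swap
  · rw [Finsupp.notMem_support_iff.1 hl]
    exact p.zero_mem
  have hfin : {n | Finsupp.linearCombination R (fun l => s l • powFamily e x (s l)) c (e n) ∉
      torsionModulo X p}.Finite := hc.preimage e.injective.injOn
  obtain ⟨m, hm⟩ := hfin.bddAbove
  have hsum : ∀ n, m + 1 ≤ n → ∑ l ∈ c.support, c l * (s l * s l ^ n) ∈ p := by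
    intro n hn
    refine mem_of_smul_mem_torsionModulo hx ?_
    by_contra hcon
    have hle : n ≤ m := hm (by
      simpa [Finsupp.linearCombination_apply, Finsupp.sum, Finset.sum_apply, powFamily_apply,
        Finset.sum_smul, mul_smul] using hcon)
    omega
  rw [← Ideal.Quotient.eq_zero_iff_mem]
  -- The extra factor `s l` raises the exponent by one, hence the bound `m + 2`.
  refine eq_zero_of_sum_mul_pow_eq_zero hs
    (fun l h => hsp l (Ideal.Quotient.eq_zero_iff_mem.1 h))
    (fun l => Ideal.Quotient.mk p (c l)) c.support (m + 2) (fun n hn => ?_) hl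
  obtain ⟨k, rfl⟩ : ∃ k, n = k + 1 := ⟨n - 1, by omega⟩
  have := Ideal.Quotient.eq_zero_iff_mem.2 (hsum k (by omega))
  simpa [pow_succ'] using this

theorem exists_isArtinian_quotient_adicClosure {R : Type*} [CommRing R] [IsLocalRing R]
    [IsNoetherianRing R] {X I : Type*} [AddCommGroup X] [Module R X] [Module.Finite R X]
    [Infinite I] {p : Ideal R} [hp : p.IsPrime] (hX : Module.annihilator R X ≤ p)
    (hpm : p < maximalIdeal R) :
    ∃ U : Submodule R (adicClosure R (fun _ : I => X)),
      (coprodInProd R (fun _ : I => X)).submoduleOf (adicClosure R (fun _ : I => X)) ≤ U ∧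
      IsArtinian R (_ ⧸ U) ∧ Module.annihilator R (_ ⧸ U) = p := by
  obtain ⟨x, hx⟩ := exists_notMem_torsionModulo hX
  let e : ℕ ↪ I := Infinite.natEmbedding I
  -- All nonzero classes of `𝔪` modulo `p`, one representative each: the ratios are then distinct in
  -- `R ⧸ p`, and no multiplier in `𝔪` outside `p` is missed.
  let Λ := {d : R ⧸ p // ∃ r ∈ maximalIdeal R, r ∉ p ∧ Ideal.Quotient.mk p r = d}
  choose s hsm hsp hs using fun d : Λ => d.2
  have hinj : Function.Injective fun l => Ideal.Quotient.mk p (s l) := by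
    intro a b hab
    simp only [hs] at hab
    exact Subtype.ext hab
  obtain ⟨r₀, hr₀m, hr₀p⟩ := SetLike.exists_of_lt hpm
  have : Nonempty Λ := ⟨⟨_, r₀, hr₀m, hr₀p, rfl⟩⟩
  let w : Λ → adicClosure R (fun _ : I => X) :=
    fun l => ⟨powFamily e x (s l), powFamily_mem_adicClosure e x (hsm l)⟩
  let K := (almostEverywhereMem I (torsionModulo X p)).submoduleOf (adicClosure R (fun _ : I => X))
  obtain ⟨U, hKU, hart, hU⟩ := exists_isArtinian_quotient_forall_notMem p hp.ne_top K
    (fun l => s l • w l) (fun c hc => by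
      refine mem_of_linearCombination_smul_powFamily_mem e hx hinj hsp c ?_
      have hmap := Finsupp.apply_linearCombination R
        (adicClosure R (fun _ : I => X)).subtype (fun l => s l • w l) c
      have hc' : (adicClosure R (fun _ : I => X)).subtype
        (Finsupp.linearCombination R (fun l => s l • w l) c) ∈
          almostEverywhereMem I (torsionModulo X p) := hc
      rw [hmap] at hc'
      exact hc')
  refine ⟨U, fun f hf => hKU (coprodInProd_le_almostEverywhereMem _ hf), hart, ?_⟩
  have hmem : ∀ r, r ∈ Module.annihilator R (_ ⧸ U) ↔ ∀ f, r • f ∈ U := by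
    intro r
    rw [Module.mem_annihilator, U.mkQ_surjective.forall]
    refine forall_congr' fun f => ?_
    rw [← map_smul, Submodule.mkQ_apply, Submodule.Quotient.mk_eq_zero]
  have hle : p ≤ Module.annihilator R (_ ⧸ U) := by
    intro r hr
    rw [hmem]
    intro f
    refine hKU ?_
    refine Set.Finite.subset Set.finite_empty fun i hi => hi ?_
    exact smul_mem_torsionModulo_of_mem hr _
  refine le_antisymm (fun r hr => ?_) hle
  by_contra hrp
  -- The factor `r₀` moves `r` into `𝔪` without entering `p`. The representative of `r * r₀` then
  -- kills the quotient, although `s l • w l ∉ U`.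
  let l : Λ := ⟨_, r * r₀, Ideal.mul_mem_left _ _ hr₀m, hp.mul_notMem hrp hr₀p, rfl⟩
  have hsl : s l ∈ Module.annihilator R (_ ⧸ U) := by
    have hsub : s l - r * r₀ ∈ p := Ideal.Quotient.eq.1 (hs l)
    simpa using Ideal.add_mem _ (hle hsub) (Ideal.mul_mem_right r₀ _ hr)
  exact hU l ((hmem _).1 hsl (w l))

theorem mainTheorem11 {R : Type*} [CommRing R] [IsLocalRing R] [IsNoetherianRing R]
    (X : Type*) [AddCommGroup X] [Module R X] [Module.Finite R X] [Nontrivial X]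
    (I : Type*) [Infinite I] :
    Koass R (adicClosure R (fun _ : I => X) ⧸
        (coprodInProd R (fun _ : I => X)).submoduleOf (adicClosure R (fun _ : I => X))) =
      {p : PrimeSpectrum R | Module.annihilator R X ≤ p.asIdeal ∧
        p.asIdeal < IsLocalRing.maximalIdeal R} := by
  ext p
  constructor
  · rintro ⟨U, -, hann⟩
    refine ⟨?_, lt_of_le_of_ne (le_maximalIdeal p.2.ne_top) ?_⟩
    · rw [← hann]
      intro r hr
      rw [Module.mem_annihilator] at hr ⊢
      intro y
      obtain ⟨y, rfl⟩ := U.mkQ_surjective y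
      obtain ⟨f, rfl⟩ := Submodule.mkQ_surjective _ y
      have : r • f = 0 := by
        ext i
        exact hr _
      rw [← map_smul, ← map_smul, this, map_zero, map_zero]
    · rw [← hann]
      exact annihilator_ne_maximalIdeal U
  · rintro ⟨hX, hpm⟩
    obtain ⟨U, hU, hart, hann⟩ := exists_isArtinian_quotient_adicClosure (I := I) hX hpm
    let φ := Submodule.quotientQuotientEquivQuotient _ U hU
    exact ⟨U.map (Submodule.mkQ _), φ.isArtinian_iff.2 hart, φ.annihilator_eq.trans hann⟩
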